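/- For $r \ge 0$ let $L_r$ be the set of all functions $f$ on $[0,1]$ with $|f(x)-f(y)| \le |x-y|$ for all $x,y\in[0,1]$ and $\left|\int_0^1 f(x)\,dx\right| \le r$; thus $L_0$ is the set of $1$-Lipschitz functions on $[0,1]$ with $\int_0^1 f(x)\,dx = 0$. For a probability distribution $p$ on $[0,1]$, let $$\mathrm{Err}(f,p) = \int_{[0,1]} \left| \int_0^1 f(y)\,dy - f(x) \right| \, dp(x)$$ be the expected error of estimating the average of $f$ by $f(x)$, where $x$ is drawn from $p$. For $b\in[0,1]$, define $f_b(x) = \frac12 + b^2 - b - |b-x|$ on $[0,1]$. Theorem. Let $c = 2-\sqrt3$ and let $p$ be the uniform distribution on $[c,1-c]$. Then for every $\varepsilon>0$ there exists $b = b(\varepsilon)\in[0,1]$ such that $f_b \in L_0$ and, for all functions $f\in L_0$, $$\mathrm{Err}(f_b,p) \ \ge\ \mathrm{Err}(f,p) - \varepsilon .$$ -/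

import Mathlib

open Set MeasureTheory

noncomputable section

namespace OneSample

/-- The average of `f` over the metric space `[0,1]` (which has length `1`). -/
def avg (f : ℝ → ℝ) : ℝ := ∫ x in (0 : ℝ)..1, f x

/-- The functions that are `1`-Lipschitz on `[0,1]` and whose average there has absolute value
at most `r`; for `r = 0` these are the mean-zero ones. Only the values of `f` on `[0,1]` matter. -/
def lipschitzClass (r : ℝ) : Set (ℝ → ℝ) :=
  {f | LipschitzOnWith 1 f (Icc 0 1) ∧ |avg f| ≤ r}

/-- The expected error, on input `f`, of the algorithm that draws `x` from the distribution `p`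
on `[0,1]` and outputs `f x` as its estimate of the average of `f`. -/
def expectedError (f : ℝ → ℝ) (p : Measure ℝ) : ℝ := ∫ x, |avg f - f x| ∂p

/-- The uniform probability distribution on `[c, 1 - c]`, for `c < 1 / 2`:
Lebesgue measure conditioned on this interval. -/
def uniformMid (c : ℝ) : Measure ℝ := ProbabilityTheory.cond volume (Icc c (1 - c))

/-- The function `f_b` on `[0,1]`, made of at most two line segments with slopes `1` and `-1`. -/
def tent (b x : ℝ) : ℝ := 1 / 2 + b ^ 2 - b - |b - x|

end OneSample

end

open Set MeasureTheory

namespace OneSample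

/-! The value `b = 1 / 2` serves every `ε`, with no loss: a mean-zero `1`-Lipschitz `g` has `∫ |g| ≤
c (1 - 2c) / 2` over `[c, 1 - c]`, and the symmetric tent attains this. Split `[c, 1 - c]` into `{g
> 0}`, of length `a`, and the rest, of length `b`. Closing the gaps where the positive part vanishes
keeps it `1`-Lipschitz, so its integral `P` is at most the area of a tent over a base of length `a`
with the same end values; likewise for the negative part, with integral `N`
(`integral_le_of_support`). On the two outer pieces the Lipschitz condition and mean zero give `|P -
N + c (g c + g (1 - c))| ≤ c ^ 2`. Polynomial inequalities remain, one for each sign pattern of the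
end values (`bound_of_same_sign`, `bound_of_opposite_sign`). -/

/-! ### Tent area bound -/

/-- Monotonicity up to a quadratic error implies monotonicity. -/
lemma le_of_sub_le_mul_sq {H : ℝ → ℝ} {c d K : ℝ} (hcd : c ≤ d)
    (hH : ∀ x y, c ≤ x → x ≤ y → H x - H y ≤ K * (y - x) ^ 2) : H c ≤ H d := by
  have step : ∀ h : ℝ, 0 ≤ h → ∀ i : ℕ, H c - H (c + i * h) ≤ i * (K * h ^ 2) := by
    intro h hh i
    induction i with
    | zero => simp
    | succ i ih =>
      have h0 : (0 : ℝ) ≤ i * h := by positivity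
      have := hH (c + i * h) (c + (i + 1 : ℕ) * h) (by linarith) (by push_cast; linarith)
      have e : c + ((i + 1 : ℕ) : ℝ) * h - (c + i * h) = h := by push_cast; ring
      rw [e] at this
      push_cast at this ⊢
      linarith
  have key : ∀ n : ℕ, H c - H d ≤ K * (d - c) ^ 2 / ((n : ℝ) + 1) := by
    intro n
    have hn : (0 : ℝ) < (n : ℝ) + 1 := by positivity
    have := step ((d - c) / (n + 1)) (div_nonneg (by linarith) hn.le) (n + 1)
    push_cast at this
    rw [mul_div_cancel₀ _ hn.ne', add_sub_cancel] at this
    refine this.trans (le_of_eq ?_)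
    field_simp
  have lim : Filter.Tendsto (fun n : ℕ => K * (d - c) ^ 2 / ((n : ℝ) + 1)) Filter.atTop
      (nhds 0) := by
    simpa [div_eq_mul_inv] using
      (tendsto_one_div_add_atTop_nhds_zero_nat (𝕜 := ℝ)).const_mul (K * (d - c) ^ 2)
  have := ge_of_tendsto' lim key
  linarith

/-- A function whose increments are controlled by those of `φ`, and whose mass is
carried by the growth of `φ`, has integral at most the area under the highest tent which joins
its boundary values over a base of length `φ d`. -/
lemma integral_le_tentArea {g φ : ℝ → ℝ} {c d : ℝ} (hcd : c ≤ d) (hg : Continuous g)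
    (hφ : ∀ x y, x ≤ y → φ y - φ x ≤ y - x)
    (hgφ : ∀ x y, x ≤ y → |g y - g x| ≤ φ y - φ x)
    (hint : ∀ x y M, x ≤ y → (∀ t ∈ Icc x y, g t ≤ M) → ∫ t in x..y, g t ≤ M * (φ y - φ x))
    (hφc : φ c = 0) :
    ∫ t in c..d, g t ≤ φ d * (g c + g d) / 2 + (φ d ^ 2 - (g c - g d) ^ 2) / 4 := by
  have hi : ∀ x y, IntervalIntegrable g volume x y := fun x y => hg.intervalIntegrable x y
  -- Slack of the tent bound on `[c, x]`. It need not be differentiable, so only its increments are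
  -- estimated.
  have := le_of_sub_le_mul_sq (K := 2) (H := fun x => φ x * (g c + g x) / 2 +
    (φ x ^ 2 - (g c - g x) ^ 2) / 4 - ∫ t in c..x, g t) hcd ?_
  · simp only [hφc, intervalIntegral.integral_same] at this
    linarith
  intro x y hcx hxy
  have h1 := hint x y (g x + (φ y - φ x)) hxy (by
    intro t ht
    have h1 := (abs_le.1 (hgφ x t ht.1)).2
    have h2 := (abs_nonneg _).trans (hgφ t y ht.2)
    linarith)
  have h2 := intervalIntegral.integral_add_adjacent_intervals (hi c x) (hi x y)
  have h3 := abs_le.1 (hgφ x y hxy)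
  have h4 := abs_le.1 (hgφ c x hcx)
  have h5 := hφ x y hxy
  have hδ : 0 ≤ φ y - φ x := (abs_nonneg _).trans (hgφ x y hxy)
  rw [← h2]
  obtain ⟨δ, hδe⟩ : ∃ δ, δ = φ y - φ x := ⟨_, rfl⟩
  obtain ⟨η, hηe⟩ : ∃ η, η = g y - g x := ⟨_, rfl⟩
  have ey : φ y = φ x + δ := by linarith
  have eg : g y = g x + η := by linarith
  rw [← hδe] at h1 h3 h5 hδ
  rw [← hηe] at h3
  rw [ey, eg]
  -- To first order the slack grows by half of this product.
  have m1 : 0 ≤ (φ x + g c - g x) * (η + δ) :=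
    mul_nonneg (by linarith) (by linarith)
  have m2 : 0 ≤ (δ - η) * (δ + η) := mul_nonneg (by linarith) (by linarith)
  have m3 : 0 ≤ δ * (δ + η) := mul_nonneg hδ (by linarith)
  have m4 : δ ^ 2 ≤ (y - x) ^ 2 := pow_le_pow_left₀ hδ h5 2
  nlinarith

/-- Next to the endpoint with the larger value, up to the nearest point where `g` is down to the
smaller one, `g` is positive. There `φ` has slope one, and the whole change of `g` is paid for. -/
lemma abs_sub_le_measure {g φ : ℝ → ℝ} (hg : LipschitzWith 1 g) (hg0 : ∀ x, 0 ≤ g x)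
    (hmono : Monotone φ)
    (hpos : ∀ x y, x ≤ y → (∀ t ∈ Ioo x y, 0 < g t) → φ y - φ x = y - x) {x y : ℝ}
    (hxy : x ≤ y) : |g y - g x| ≤ φ y - φ x := by
  have hL : ∀ s t, |g s - g t| ≤ |s - t| := fun s t => by
    simpa [Real.dist_eq] using hg.dist_le_mul s t
  have hcont := hg.continuous
  rw [abs_le]
  constructor
  · rcases le_total (g x) (g y) with h | h
    · have := hmono hxy; linarith
    have hK : IsCompact (Icc x y ∩ {t | g t ≤ g y}) :=
      isCompact_Icc.inter_right (isClosed_le hcont continuous_const)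
    obtain ⟨z, ⟨⟨hz, hz'⟩, hzl⟩⟩ := hK.exists_isLeast ⟨y, ⟨hxy, le_rfl⟩, le_rfl (a := g y)⟩
    have e := hpos x z hz.1 (fun t ht => by
      by_contra hc
      have := hzl ⟨⟨ht.1.le, ht.2.le.trans hz.2⟩, (not_lt.1 hc).trans (hg0 y)⟩
      linarith [ht.2])
    have h1 := (abs_le.1 (hL x z)).2
    have h2 := hmono hz.2
    have h3 := (abs_le.1 (hL z x)).1
    rw [abs_of_nonneg (by linarith [hz.1])] at h3
    simp only [mem_ofPred_eq] at hz'
    linarith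
  · rcases le_total (g y) (g x) with h | h
    · have := hmono hxy; linarith
    have hK : IsCompact (Icc x y ∩ {t | g t ≤ g x}) :=
      isCompact_Icc.inter_right (isClosed_le hcont continuous_const)
    obtain ⟨z, ⟨⟨hz, hz'⟩, hzl⟩⟩ := hK.exists_isGreatest ⟨x, ⟨le_rfl, hxy⟩, le_rfl (a := g x)⟩
    have e := hpos z y hz.2 (fun t ht => by
      by_contra hc
      have := hzl ⟨⟨hz.1.trans ht.1.le, ht.2.le⟩, (not_lt.1 hc).trans (hg0 x)⟩
      linarith [ht.1])
    have h2 := hmono hz.1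
    have h3 := (abs_le.1 (hL y z)).2
    rw [abs_of_nonneg (by linarith [hz.2])] at h3
    simp only [mem_ofPred_eq] at hz'
    linarith

lemma indicator_intervalIntegrable {S : Set ℝ} (hS : MeasurableSet S) (x y : ℝ) :
    IntervalIntegrable (S.indicator (fun _ => (1 : ℝ))) volume x y := by
  rw [intervalIntegrable_iff]
  exact (integrableOn_const (by simp)).indicator hS

/-- The tent area bound for a nonnegative `1`-Lipschitz function that vanishes off `S`, together
with the bound on its increment. -/
lemma integral_le_of_support {g : ℝ → ℝ} {S : Set ℝ} (hS : MeasurableSet S)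
    (hg : LipschitzWith 1 g) (hg0 : ∀ x, 0 ≤ g x) (hgS : ∀ x, 0 < g x → x ∈ S) {c d a : ℝ}
    (hcd : c ≤ d) (ha : a = ∫ t in c..d, S.indicator (fun _ => (1 : ℝ)) t) :
    |g d - g c| ≤ a ∧
    ∫ t in c..d, g t ≤ a * (g c + g d) / 2 + (a ^ 2 - (g c - g d) ^ 2) / 4 := by
  have hI := indicator_intervalIntegrable hS
  set i : ℝ → ℝ := S.indicator (fun _ => (1 : ℝ)) with hi
  have hi0 : ∀ t, 0 ≤ i t := fun t => indicator_nonneg (fun _ _ => zero_le_one) t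
  have hi1 : ∀ t, i t ≤ 1 := fun t => indicator_le_self' (fun _ _ => zero_le_one) t
  have hsub : ∀ x y, (∫ t in c..y, i t) - (∫ t in c..x, i t) = ∫ t in x..y, i t := fun x y =>
    intervalIntegral.integral_interval_sub_left (hI c y) (hI c x)
  have hmono : Monotone (fun x => ∫ t in c..x, i t) := fun x y hxy => by
    have := intervalIntegral.integral_nonneg hxy (fun t _ => hi0 t) (μ := volume)
    have := hsub x y
    linarith
  have habs : ∀ x y, x ≤ y → |g y - g x| ≤ (∫ t in c..y, i t) - ∫ t in c..x, i t := by
    intro x y hxy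
    refine abs_sub_le_measure hg hg0 hmono (fun x y hxy hp => ?_) hxy
    rw [hsub, intervalIntegral.integral_of_le hxy, integral_Ioc_eq_integral_Ioo,
      setIntegral_congr_fun (g := fun _ => (1 : ℝ)) measurableSet_Ioo
        (fun t ht => indicator_of_mem (hgS t (hp t ht)) _)]
    simp [hxy]
  have := integral_le_tentArea (φ := fun x => ∫ t in c..x, i t) hcd hg.continuous ?_ habs ?_
    (by simp)
  · refine ⟨?_, by rw [ha]; exact this⟩
    have := habs c d hcd
    rwa [intervalIntegral.integral_same, sub_zero, ← ha] at this
  · intro x y hxy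
    rw [hsub]
    have := intervalIntegral.integral_mono_on hxy (hI x y) (intervalIntegrable_const (c := (1 : ℝ)))
      (fun t _ => hi1 t) (μ := volume)
    simpa using this
  · intro x y M hxy hM
    rw [hsub, ← intervalIntegral.integral_const_mul]
    refine intervalIntegral.integral_mono_on hxy (hg.continuous.intervalIntegrable _ _)
      ((hI x y).const_mul M) (fun t ht => ?_)
    by_cases hs : t ∈ S
    · simpa [hi, hs] using hM t ht
    · simpa [hi, hs] using not_lt.1 (fun h => hs (hgS t h))

/-! ### Polynomial inequalities -/

/-- Weighting `hm` by `a / 2` and `hP` by `c` eliminates `u + v`. The remaining slack is `b / 2 * (c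
- b * (1 - b))`, whence `1 / 4 ≤ c`. -/
lemma bound_of_same_sign {c L a b u v P N : ℝ} (hc : 1 / 4 ≤ c) (hL : L = 1 - 2 * c)
    (hab : a + b = L) (ha : 0 ≤ a) (hb : 0 ≤ b)
    (hP : P ≤ a * (u + v) / 2 + (a ^ 2 - (u - v) ^ 2) / 4) (hN : N ≤ b ^ 2 / 4)
    (hm : P - N + c * (u + v) ≤ c ^ 2) : P + N ≤ c * L / 2 := by
  have hac : 0 < a + 2 * c := by linarith
  have h1 : (a / 2 + c) * P ≤ a / 2 * (c ^ 2 + N) + c * (a ^ 2 / 4) := by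
    have e1 : a / 2 * P ≤ a / 2 * (c ^ 2 + N - c * (u + v)) :=
      mul_le_mul_of_nonneg_left (by linarith) (by linarith)
    have e2 : c * P ≤ c * (a * (u + v) / 2 + a ^ 2 / 4) :=
      mul_le_mul_of_nonneg_left (by nlinarith [sq_nonneg (u - v)]) (by linarith)
    linarith
  have h2 : (a + 2 * c) * (P + N) ≤ a * c ^ 2 + (2 * a + 2 * c) * (b ^ 2 / 4) + c * a ^ 2 / 2 := by
    have := mul_le_mul_of_nonneg_left hN (by linarith : 0 ≤ 2 * a + 2 * c)
    linarith
  have h3 : b * (b * (1 - b)) ≤ b * c :=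
    mul_le_mul_of_nonneg_left (by nlinarith [sq_nonneg (b - 1 / 2)]) hb
  have h4 : (a + 2 * c) * (P + N) ≤ (a + 2 * c) * (c * L / 2) := by
    refine h2.trans ?_
    obtain rfl : a = 1 - 2 * c - b := by linarith
    subst hL
    nlinarith
  exact le_of_mul_le_mul_left h4 hac

/-- Here `v` is minus the right end value. If the bound failed, the areas would bound `k = a - u`
above and the mean condition would bound it below; at `c = 2 - √3` these just exclude each other. -/
lemma bound_of_opposite_sign {c s L a b u v P N : ℝ} (hs : s ^ 2 = 3) (hs0 : 0 ≤ s)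
    (hc : c = 2 - s)
    (hL : L = 1 - 2 * c) (hab : a + b = L) (hba : b ≤ a) (hb : 0 ≤ b) (hu : u ≤ a) (hv : v ≤ b)
    (hP : P ≤ a * u / 2 + (a ^ 2 - u ^ 2) / 4)
    (hN : N ≤ b * v / 2 + (b ^ 2 - v ^ 2) / 4)
    (hm : P - N + c * (u - v) ≤ c ^ 2) : P + N ≤ c * L / 2 := by
  have s1 : 1.73 < s := by nlinarith
  have s2 : s < 1.7321 := by nlinarith
  have hN' : N ≤ b ^ 2 / 2 := by nlinarith [sq_nonneg (b - v)]
  by_contra! hK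
  obtain ⟨k, hk⟩ : ∃ k, k = a - u := ⟨_, rfl⟩
  have h1 : c * L / 2 < a ^ 2 / 2 + b ^ 2 / 2 - k ^ 2 / 4 := by rw [hk]; nlinarith
  have hcv : c * v ≤ c * b := mul_le_mul_of_nonneg_left hv (by linarith)
  have h2 : c * L / 2 - c ^ 2 + c * (a - b) - b ^ 2 < c * k := by rw [hk]; linarith
  -- `k0` is the left side of `h2` divided by `c`, using `1 / c = 2 + s`.
  obtain ⟨k0, hk0⟩ : ∃ k0, k0 = 4 * s - 13 / 2 - 2 * b - (2 + s) * b ^ 2 := ⟨_, rfl⟩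
  have hcc : c * (2 + s) = 1 := by subst hc; nlinarith
  have h3 : k0 < k := by
    refine lt_of_mul_lt_mul_left (a := c) ?_ (by linarith)
    refine lt_of_eq_of_lt ?_ h2
    obtain rfl : a = L - b := by linarith
    rw [hk0]
    subst hL
    subst hc
    linear_combination b ^ 2 * hs
  -- The cutoff is small enough to give `0 ≤ k0` below it, and large enough that above it the areas
  -- alone suffice.
  have hb15 : b ≤ 0.15 := by
    by_contra! hb15
    have e : a ^ 2 + b ^ 2 ≤ c * L := by
      obtain rfl : a = L - b := by linarith
      have e1 : 0 ≤ (b - 0.15) * (L - 0.15 - b) := mul_nonneg (by linarith) (by linarith)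
      have e2 : L ^ 2 - 0.3 * (L - 0.15) ≤ c * L := by subst hL; subst hc; nlinarith
      nlinarith
    nlinarith [sq_nonneg k]
  have h4 : 0 ≤ k0 := by
    have e1 : b ^ 2 ≤ 0.15 ^ 2 := pow_le_pow_left₀ hb hb15 2
    have e2 : (2 + s) * b ^ 2 ≤ (2 + s) * 0.15 ^ 2 :=
      mul_le_mul_of_nonneg_left e1 (by linarith)
    rw [hk0]
    linarith
  have h5 : k0 ^ 2 < k ^ 2 := pow_lt_pow_left₀ h3 h4 two_ne_zero
  -- The gap between the two bounds on `k ^ 2` has a double root in `b`, so it never becomes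
  -- negative.
  have h6 : 0 ≤ (b - (3 * s / 2 - 5 / 2)) ^ 2 *
      ((2 + s) ^ 2 * b ^ 2 + (9 + 5 * s) * b + (1 - s / 2)) := by
    have : 0 ≤ 1 - s / 2 := by linarith
    positivity
  have h7 : (b - (3 * s / 2 - 5 / 2)) ^ 2 *
      ((2 + s) ^ 2 * b ^ 2 + (9 + 5 * s) * b + (1 - s / 2)) =
      k0 ^ 2 - 2 * (a ^ 2 + b ^ 2) + 2 * (c * L) := by
    obtain rfl : a = L - b := by linarith
    rw [hk0]
    subst hL
    subst hc
    have hs3 : s ^ 3 = 3 * s := by rw [pow_succ, hs]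
    have hs4 : s ^ 4 = 9 := by rw [show 4 = 2 * 2 by norm_num, pow_mul, hs]; norm_num
    ring_nf
    simp only [hs, hs3, hs4]
    ring
  linarith

/-! ### Upper bound for mean-zero functions -/

lemma abs_integral_sub_le {g : ℝ → ℝ} (hg : LipschitzWith 1 g) {x y z : ℝ} (hxy : x ≤ y)
    (hz : z = x ∨ z = y) :
    |(∫ t in x..y, g t) - (y - x) * g z| ≤ (y - x) ^ 2 / 2 := by
  have hL : ∀ s t, |g s - g t| ≤ |s - t| := fun s t => by
    simpa [Real.dist_eq] using hg.dist_le_mul s t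
  have e : (∫ t in x..y, g t) - (y - x) * g z = ∫ t in x..y, (g t - g z) := by
    rw [intervalIntegral.integral_sub (hg.continuous.intervalIntegrable _ _) (by simp)]
    simp
  rw [e]
  refine (intervalIntegral.abs_integral_le_integral_abs hxy).trans ?_
  have hc : Continuous fun t => |g t - g z| := (hg.continuous.sub continuous_const).abs
  rcases hz with rfl | rfl
  · have := intervalIntegral.integral_mono_on (μ := volume) (g := fun t => t - z) hxy
      (hc.intervalIntegrable _ _) ((by fun_prop : Continuous fun t => t - z).intervalIntegrable _ _)
      (fun t ht => (hL t z).trans_eq (abs_of_nonneg (by linarith [ht.1])))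
    refine this.trans_eq ?_
    simp
    ring
  · have := intervalIntegral.integral_mono_on (μ := volume) (g := fun t => z - t) hxy
      (hc.intervalIntegrable _ _) ((by fun_prop : Continuous fun t => z - t).intervalIntegrable _ _)
      (fun t ht => (hL t z).trans_eq (by rw [abs_of_nonpos (by linarith [ht.2])]; ring))
    refine this.trans_eq ?_
    rw [intervalIntegral.integral_sub (by simp) (by simp)]
    simp
    ring

/-- The sharp bound on the integral of `|g|` over `[c, 1 - c]`, `c = 2 - √3`, for a `1`-Lipschitz
function of mean zero on `[0,1]`. -/
lemma integral_abs_le {g : ℝ → ℝ} (hg : LipschitzWith 1 g) (hg0 : ∫ t in (0 : ℝ)..1, g t = 0)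
    {s c : ℝ} (hs : s ^ 2 = 3) (hs0 : 0 ≤ s) (hc : c = 2 - s) :
    ∫ t in c..(1 - c), |g t| ≤ c * (1 - 2 * c) / 2 := by
  have s1 : 1.73 < s := by nlinarith
  have s2 : s < 1.7321 := by nlinarith
  wlog hgc : 0 ≤ g c generalizing g
  · have := this (g := fun t => -g t) hg.neg (by simp [hg0]) (by linarith)
    simpa using this
  have hi : ∀ x y, IntervalIntegrable g volume x y :=
    fun x y => hg.continuous.intervalIntegrable x y
  have hcd : c ≤ 1 - c := by linarith
  obtain ⟨S, hS⟩ : ∃ S, S = {x | 0 < g x} := ⟨_, rfl⟩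
  have hSm : MeasurableSet S := by
    rw [hS]
    exact (isOpen_lt continuous_const hg.continuous).measurableSet
  obtain ⟨a, ha⟩ : ∃ a, a = ∫ t in c..(1 - c), S.indicator (fun _ => (1 : ℝ)) t := ⟨_, rfl⟩
  obtain ⟨b, hb⟩ : ∃ b, b = ∫ t in c..(1 - c), Sᶜ.indicator (fun _ => (1 : ℝ)) t := ⟨_, rfl⟩
  have hab : a + b = 1 - 2 * c := by
    rw [ha, hb, ← intervalIntegral.integral_add (indicator_intervalIntegrable hSm _ _)
      (indicator_intervalIntegrable hSm.compl _ _)]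
    simp only [indicator_self_add_compl_apply]
    simp
    ring
  obtain ⟨hpa, hP⟩ := integral_le_of_support hSm (hg.max_const 0) (fun x => le_max_right _ _)
    (fun x hx => by rw [hS]; simpa using hx) hcd ha
  obtain ⟨hnb, hN⟩ := integral_le_of_support hSm.compl (hg.neg.max_const 0)
    (fun x => le_max_right _ _)
    (fun x hx => by rw [hS]; simpa using (show 0 < -g x by simpa using hx).le) hcd hb
  obtain ⟨P, hPe⟩ : ∃ P, P = ∫ t in c..(1 - c), max (g t) 0 := ⟨_, rfl⟩
  obtain ⟨N, hNe⟩ : ∃ N, N = ∫ t in c..(1 - c), max (-g t) 0 := ⟨_, rfl⟩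
  have hiP : IntervalIntegrable (fun t => max (g t) 0) volume c (1 - c) :=
    (hg.max_const 0).continuous.intervalIntegrable _ _
  have hiN : IntervalIntegrable (fun t => max (-g t) 0) volume c (1 - c) :=
    (hg.neg.max_const 0).continuous.intervalIntegrable _ _
  have hsum : ∫ t in c..(1 - c), |g t| = P + N := by
    rw [hPe, hNe, ← intervalIntegral.integral_add hiP hiN]
    congr 1 with t
    rcases le_total 0 (g t) with h | h
    · simp [h, abs_of_nonneg h]
    · simp [h, abs_of_nonpos h]
  have hdiff : ∫ t in c..(1 - c), g t = P - N := by
    rw [hPe, hNe, ← intervalIntegral.integral_sub hiP hiN]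
    congr 1 with t
    rcases le_total 0 (g t) with h | h
    · simp [h]
    · simp [h]
  simp only [← hPe] at hP
  simp only [Pi.neg_apply] at hN hnb
  rw [← hNe] at hN
  have hl := abs_le.1 (abs_integral_sub_le hg (x := 0) (by linarith : 0 ≤ c) (Or.inr rfl))
  have hr := abs_le.1 (abs_integral_sub_le hg (by linarith : 1 - c ≤ 1) (Or.inl rfl))
  have hsplit : (∫ t in (0 : ℝ)..c, g t) + (P - N) + ∫ t in (1 - c)..1, g t = 0 := by
    rw [← hdiff, intervalIntegral.integral_add_adjacent_intervals (hi _ _) (hi _ _),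
      intervalIntegral.integral_add_adjacent_intervals (hi _ _) (hi _ _), hg0]
  rw [hsum]
  have ha0 := (abs_nonneg _).trans hpa
  have hb0 := (abs_nonneg _).trans hnb
  rw [max_eq_left hgc] at hP hpa
  rw [max_eq_right (neg_nonpos.2 hgc)] at hN hnb
  rcases le_total 0 (g (1 - c)) with hgd | hgd
  · rw [max_eq_left hgd] at hP
    rw [max_eq_right (neg_nonpos.2 hgd)] at hN
    exact bound_of_same_sign (a := a) (b := b) (u := g c) (v := g (1 - c)) (by linarith) rfl hab
      ha0 hb0 hP (by linarith) (by linarith)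
  · rw [max_eq_right hgd] at hP hpa
    rw [max_eq_left (neg_nonneg.2 hgd)] at hN hnb
    have hpa := (abs_le.1 hpa).1
    have hnb := (abs_le.1 hnb).2
    rcases le_total b a with hba | hba
    · exact bound_of_opposite_sign (a := a) (b := b) (u := g c) (v := -g (1 - c)) hs hs0 hc rfl
        hab hba hb0 (by linarith) (by linarith) (by linarith) (by linarith) (by linarith)
    -- The hypotheses are symmetric under reflecting and negating `g`, which swaps `a` with `b` and
    -- `u` with `v`.
    · rw [add_comm]
      exact bound_of_opposite_sign (a := b) (b := a) (u := -g (1 - c)) (v := g c) hs hs0 hc rfl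
        (by linarith) hba ha0 (by linarith) (by linarith) (by linarith) (by linarith) (by linarith)

/-! ### The symmetric tent attains the bound -/

lemma expectedError_uniformMid {c : ℝ} (hc : c ≤ 1 / 2) (f : ℝ → ℝ) :
    expectedError f (uniformMid c) = (1 - 2 * c)⁻¹ * ∫ t in c..(1 - c), |avg f - f t| := by
  have h : c ≤ 1 - c := by linarith
  rw [expectedError, uniformMid, ProbabilityTheory.cond, integral_smul_measure,
    intervalIntegral.integral_of_le h, integral_Icc_eq_integral_Ioc, Real.volume_Icc,
    ENNReal.toReal_inv, ENNReal.toReal_ofReal (by linarith), smul_eq_mul]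
  ring_nf

lemma tent_lipschitzWith (b : ℝ) : LipschitzWith 1 (tent b) := by
  refine LipschitzWith.of_dist_le_mul fun x y => ?_
  simp only [tent, Real.dist_eq, NNReal.coe_one, one_mul, sub_sub_sub_cancel_left]
  refine (abs_abs_sub_abs_le _ _).trans_eq ?_
  congr 1
  ring

lemma integral_tent_half {d : ℝ} (hd : 0 ≤ d) :
    ∫ t in (1 / 2 - d)..(1 / 2 + d), tent (1 / 2) t = d / 2 - d ^ 2 := by
  have hi : ∀ x y, IntervalIntegrable (tent (1 / 2)) volume x y :=
    fun x y => (tent_lipschitzWith _).continuous.intervalIntegrable x y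
  rw [← intervalIntegral.integral_add_adjacent_intervals (hi _ (1 / 2)) (hi _ _),
    intervalIntegral.integral_congr (a := 1 / 2 - d) (g := fun t => t - 1 / 4),
    intervalIntegral.integral_congr (b := 1 / 2 + d) (g := fun t => 3 / 4 - t)]
  · rw [intervalIntegral.integral_sub (by simp) (by simp),
      intervalIntegral.integral_sub (by simp) (by simp)]
    simp
    ring
  · intro t ht
    rw [uIcc_of_le (by linarith)] at ht
    simp only [tent]
    rw [abs_of_nonpos (by linarith [ht.1])]
    ring
  · intro t ht
    rw [uIcc_of_le (by linarith)] at ht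
    simp only [tent]
    rw [abs_of_nonneg (by linarith [ht.2])]
    ring

lemma avg_tent_half : avg (tent (1 / 2)) = 0 := by
  have := integral_tent_half (d := 1 / 2) (by norm_num)
  norm_num at this
  simpa [avg] using this

end OneSample

theorem mainTheorem2 (ε : ℝ) (hε : 0 < ε) :
    ∃ b : ℝ, b ∈ Set.Icc (0 : ℝ) 1 ∧ OneSample.tent b ∈ OneSample.lipschitzClass 0 ∧
      ∀ f ∈ OneSample.lipschitzClass 0,
        OneSample.expectedError f (OneSample.uniformMid (2 - Real.sqrt 3)) - ε ≤
          OneSample.expectedError (OneSample.tent b)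
            (OneSample.uniformMid (2 - Real.sqrt 3)) := by
  refine ⟨1 / 2, by norm_num, ⟨(OneSample.tent_lipschitzWith _).lipschitzOnWith, ?_⟩, ?_⟩
  · rw [OneSample.avg_tent_half, abs_zero]
  rintro f ⟨hf, hf0⟩
  have hs : Real.sqrt 3 ^ 2 = 3 := Real.sq_sqrt (by norm_num)
  have hs0 := Real.sqrt_nonneg 3
  obtain ⟨c, hc⟩ : ∃ c, c = 2 - Real.sqrt 3 := ⟨_, rfl⟩
  have hc0 : 0 ≤ c := by nlinarith
  have hc1 : c < 1 / 2 := by nlinarith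
  rw [← hc, OneSample.expectedError_uniformMid hc1.le, OneSample.expectedError_uniformMid hc1.le,
    OneSample.avg_tent_half, abs_nonpos_iff.1 hf0]
  simp only [zero_sub, abs_neg]
  have hL : 0 ≤ (1 - 2 * c)⁻¹ := inv_nonneg.2 (by linarith)
  refine (sub_le_self _ hε.le).trans (mul_le_mul_of_nonneg_left ?_ hL)
  trans c * (1 - 2 * c) / 2
  · obtain ⟨g, hg, hfg⟩ := hf.extend_real
    rw [intervalIntegral.integral_congr (g := fun t => |g t|)]
    · refine OneSample.integral_abs_le hg ?_ hs hs0 hc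
      refine Eq.trans ?_ (abs_nonpos_iff.1 hf0)
      refine intervalIntegral.integral_congr fun t ht => (hfg ?_).symm
      rwa [uIcc_of_le zero_le_one] at ht
    · intro t ht
      rw [uIcc_of_le (by linarith)] at ht
      simp only [hfg ⟨hc0.trans ht.1, ht.2.trans (by linarith)⟩]
  -- Dropping the absolute value only lowers the integral, and the signed one already equals the
  -- bound.
  · have h := OneSample.integral_tent_half (d := 1 / 2 - c) (by linarith)
    rw [sub_sub_cancel, show 1 / 2 + (1 / 2 - c) = 1 - c by ring] at h
    have hcont := (OneSample.tent_lipschitzWith (1 / 2)).continuous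
    have h2 := intervalIntegral.integral_mono_on (μ := volume) (by linarith : c ≤ 1 - c)
      (hcont.intervalIntegrable _ _) (hcont.abs.intervalIntegrable _ _) (fun t _ => le_abs_self _)
    rw [h] at h2
    refine le_trans (le_of_eq ?_) h2
    subst hc
    ring
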